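/- Let $f:\mathbb R^n\to\mathbb R^n$ be continuous with $f(0)=0$ and locally Lipschitz on $\mathbb R^n\setminus\{0\}$, and assume that for every initial condition $x(0)\in\mathbb R^n$ the system $\dot x=f(x)$ has a unique solution on $[0,\infty)$. Call a set $S\subset\mathbb R^n$ invariant if every solution with $x(0)\in S$ satisfies $x(t)\in S$ for all $t\ge 0$. Let $V:\mathbb R^n\to\mathbb R$ be continuously differentiable with locally Lipschitz gradient, with compact sublevel sets and bounded from below, and let $L_fV(x)=\nabla V(x)^{T}f(x)$ satisfy $L_fV(x)\le 0$ for all $x$. Put $M=\{x : L_fV(x)=0\}$. For $W:\mathbb R^n\to\mathbb R$ let $$\tilde L_fW(x)=\{\eta^Tf(x) : \eta\in\partial W(x)\},\qquad \partial W(x)=\mathrm{co}\Big\{\lim_{i\to\infty}\nabla W(x_i) : x_i\to x,\ x_i\notin Z,\ W \text{ differentiable at } x_i\Big\},$$ where $Z\subset\mathbb R^n$ is any fixed set of Lebesgue measure zero. Let $\phi:[0,\infty)\to[0,\infty)$ be continuous and monotonically increasing with $\phi(0)=0$, $\phi(r)>0$ for $r>0$, and $\int_0^{r}\frac{dv}{\phi(v)}<\infty$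 for all $r\ge 0$. Then: 1. For each $x(0)\in\mathbb R^n$ the (compact) sublevel set $\{y : V(y)\le V(x(0))\}$, which contains $x(0)$, is invariant. 2. Let $S\subset\mathbb R^n$ be any invariant set (for instance a set as in 1) such that $\min\tilde L_f(L_fV)(y)\ge\phi(-L_fV(y))$ for all $y\in S\setminus M$, and let $E$ be the largest invariant set contained in $M\cap S$. Then every solution with $x(0)\in S$ reaches $E$, and remains in it thereafter, within a finite time $T\le\int_0^{-L_fV(x(0))}\frac{dv}{\phi(v)}$. 3. If moreover $\int_0^{r}\frac{dv}{\phi(v)}\le T_M<\infty$ for all $r\ge 0$, then every solution with $x(0)\in S$ reaches $E$, and remains in it thereafter, within the fixed time $T_M$. -/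

import Mathlib

open Filter Topology MeasureTheory

/-- `x` is a solution on `[0, ∞)` of `ẋ = f(x)`, `x(0) = x₀` (one-sided derivative at `t = 0`). -/
def IsSolution {n : ℕ} (f : EuclideanSpace ℝ (Fin n) → EuclideanSpace ℝ (Fin n))
    (x₀ : EuclideanSpace ℝ (Fin n)) (x : ℝ → EuclideanSpace ℝ (Fin n)) : Prop :=
  x 0 = x₀ ∧ ∀ t : ℝ, 0 ≤ t → HasDerivWithinAt x (f (x t)) (Set.Ici 0) t

/-- Existence and uniqueness of the solution on `[0, ∞)` for every initial condition. -/
def HasUniqueSolutions {n : ℕ}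
    (f : EuclideanSpace ℝ (Fin n) → EuclideanSpace ℝ (Fin n)) : Prop :=
  ∀ x₀ : EuclideanSpace ℝ (Fin n), ∃ x : ℝ → EuclideanSpace ℝ (Fin n),
    IsSolution f x₀ x ∧ ∀ y, IsSolution f x₀ y → Set.EqOn y x (Set.Ici 0)

/-- (Strong) invariance: every solution starting in `S` satisfies `x(t) ∈ S` for all `t ≥ 0`. -/
def StronglyInvariant {n : ℕ} (f : EuclideanSpace ℝ (Fin n) → EuclideanSpace ℝ (Fin n))
    (S : Set (EuclideanSpace ℝ (Fin n))) : Prop :=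
  ∀ x₀ ∈ S, ∀ x : ℝ → EuclideanSpace ℝ (Fin n), IsSolution f x₀ x → ∀ t : ℝ, 0 ≤ t → x t ∈ S

/-- The largest invariant subset of `A`: the union of all invariant subsets of `A`. -/
def largestInvariantSubset {n : ℕ}
    (f : EuclideanSpace ℝ (Fin n) → EuclideanSpace ℝ (Fin n))
    (A : Set (EuclideanSpace ℝ (Fin n))) : Set (EuclideanSpace ℝ (Fin n)) :=
  ⋃₀ {B | B ⊆ A ∧ StronglyInvariant f B}

/-- The largest invariant subset is indeed the greatest among the invariant subsets of `A`. -/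
theorem isGreatest_largestInvariantSubset {n : ℕ}
    (f : EuclideanSpace ℝ (Fin n) → EuclideanSpace ℝ (Fin n))
    (A : Set (EuclideanSpace ℝ (Fin n))) :
    IsGreatest {B | B ⊆ A ∧ StronglyInvariant f B} (largestInvariantSubset f A) := by
  refine ⟨⟨Set.sUnion_subset fun B hB => hB.1, ?_⟩, fun B hB => Set.subset_sUnion_of_mem hB⟩
  rintro x₀ ⟨B, hB, hx₀⟩ x hx t ht
  exact ⟨B, hB, hB.2 x₀ hx₀ x hx t ht⟩

/-- The Lie derivative `L_f V (x) = (∂V/∂x) f(x)` of a differentiable function `V`. -/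
noncomputable def lieDeriv {n : ℕ} (f : EuclideanSpace ℝ (Fin n) → EuclideanSpace ℝ (Fin n))
    (V : EuclideanSpace ℝ (Fin n) → ℝ) (x : EuclideanSpace ℝ (Fin n)) : ℝ :=
  fderiv ℝ V x (f x)

/-- The generalized gradient
`∂W(x) = co {lim ∇W(xᵢ) | xᵢ → x, xᵢ ∉ Z, W differentiable at xᵢ}`, where `Z` is a set of measure
zero (on whose choice the result does not depend where `W` is locally Lipschitz). -/
def clarkeGradient {n : ℕ} (Z : Set (EuclideanSpace ℝ (Fin n)))
    (W : EuclideanSpace ℝ (Fin n) → ℝ) (x : EuclideanSpace ℝ (Fin n)) :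
    Set (EuclideanSpace ℝ (Fin n)) :=
  convexHull ℝ {η | ∃ u : ℕ → EuclideanSpace ℝ (Fin n), Tendsto u atTop (𝓝 x) ∧
    (∀ i, u i ∉ Z ∧ DifferentiableAt ℝ W (u i)) ∧
    Tendsto (fun i => gradient W (u i)) atTop (𝓝 η)}

/-- The set-valued Lie derivative `L̃_f W (x) = {ηᵀ f(x) | η ∈ ∂W(x)}`. -/
def setLieDeriv {n : ℕ} (Z : Set (EuclideanSpace ℝ (Fin n)))
    (f : EuclideanSpace ℝ (Fin n) → EuclideanSpace ℝ (Fin n))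
    (W : EuclideanSpace ℝ (Fin n) → ℝ) (x : EuclideanSpace ℝ (Fin n)) : Set ℝ :=
  {a | ∃ η ∈ clarkeGradient Z W x, inner ℝ η (f x) = a}

/-- The trajectory `x` reaches the set `E`, and stays there, from some time `T ≤ B` on. -/
def ReachesWithin {n : ℕ} (x : ℝ → EuclideanSpace ℝ (Fin n))
    (E : Set (EuclideanSpace ℝ (Fin n))) (B : ℝ) : Prop :=
  ∃ T : ℝ, 0 ≤ T ∧ T ≤ B ∧ ∀ t : ℝ, T ≤ t → x t ∈ E

/-! Along a solution, put `u t = -lieDeriv f V (x t) ≥ 0`. Where `u > 0` the state is not the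
origin, so `L_f V` is locally Lipschitz there, and the bound on its set-valued derivative gives `u`
a right Dini decay rate of at least `φ (u t)` (`decaysAtRate_neg_lieDeriv`). Hence `Φ(u)`, with
`Φ(r) = ∫₀ʳ dv/φ(v)`, falls at unit rate while `u > 0` (`integral_one_div_le_sub`), so `u` vanishes
at some time `T ≤ Φ(u 0)` and cannot leave zero again. By uniqueness of solutions the tail `x ''
Set.Ici T` is invariant; it lies in `M ∩ S`, hence in `E`. -/

/-! ### Generalized gradients and growth along a curve. -/

section LowerDini

variable {n : ℕ}

/-- Fubini: for each fixed `t` the bad `y` form a translate of a null set. -/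
theorem ae_ae_add_smul_notMem {N : Set (EuclideanSpace ℝ (Fin n))} (hN : volume N = 0)
    (v : EuclideanSpace ℝ (Fin n)) :
    ∀ᵐ y : EuclideanSpace ℝ (Fin n), ∀ᵐ t : ℝ, y + t • v ∉ N := by
  have hN' : volume (toMeasurable volume N) = 0 := by rwa [measure_toMeasurable]
  have hmeas : MeasurableSet {z : EuclideanSpace ℝ (Fin n) × ℝ |
      z.1 + z.2 • v ∉ toMeasurable volume N} := by
    have hc : Measurable fun z : EuclideanSpace ℝ (Fin n) × ℝ => z.1 + z.2 • v := by fun_prop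
    exact hc (measurableSet_toMeasurable volume N).compl
  have h : ∀ᵐ t : ℝ, ∀ᵐ y : EuclideanSpace ℝ (Fin n), y + t • v ∉ toMeasurable volume N := by
    refine Eventually.of_forall fun t => ?_
    have := (measurePreserving_add_right (volume : Measure (EuclideanSpace ℝ (Fin n)))
      (t • v)).quasiMeasurePreserving.ae (p := fun z => z ∉ toMeasurable volume N)
      (measure_eq_zero_iff_ae_notMem.1 hN')
    exact this
  filter_upwards [(Measure.ae_ae_comm hmeas).2 h] with y hy
  filter_upwards [hy] with t ht hmem
  exact ht (subset_toMeasurable volume N hmem)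

/-- `W` is absolutely continuous along the segment, so its derivative can be integrated. -/
theorem mul_le_sub_of_ae_fderiv_ge_of_ae_line {W : EuclideanSpace ℝ (Fin n) → ℝ}
    {K : NNReal} {U : Set (EuclideanSpace ℝ (Fin n))} (hUc : Convex ℝ U)
    (hW : LipschitzOnWith K W U) {v y : EuclideanSpace ℝ (Fin n)} {c h : ℝ} (hh : 0 ≤ h)
    (hy : y ∈ U) (hyh : y + h • v ∈ U)
    (hae : ∀ᵐ t : ℝ, y + t • v ∈ U →
      DifferentiableAt ℝ W (y + t • v) ∧ c ≤ fderiv ℝ W (y + t • v) v) :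
    c * h ≤ W (y + h • v) - W y := by
  have hseg : ∀ t ∈ Set.Icc 0 h, y + t • v ∈ U := by
    intro t ht
    rcases hh.eq_or_lt with rfl | hpos
    · obtain rfl : t = 0 := le_antisymm ht.2 ht.1
      exact hyh
    · have := hUc.add_smul_sub_mem hy hyh (t := t / h)
        ⟨div_nonneg ht.1 hh, (div_le_one hpos).2 ht.2⟩
      rwa [add_sub_cancel_left, smul_smul, div_mul_cancel₀ _ hpos.ne'] at this
  have hline : LipschitzWith ‖v‖₊ fun t : ℝ => y + t • v := by
    refine LipschitzWith.of_dist_le_mul fun s t => ?_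
    rw [dist_add_left, dist_eq_norm, ← sub_smul, norm_smul, dist_eq_norm, coe_nnnorm, mul_comm]
  have hlip : LipschitzOnWith (K * ‖v‖₊) (fun t : ℝ => W (y + t • v)) (Set.uIcc 0 h) := by
    rw [Set.uIcc_of_le hh]
    exact hW.comp (hline.lipschitzOnWith) hseg
  have hac := hlip.absolutelyContinuousOnInterval
  have hle : ∫ _ in (0 : ℝ)..h, c ≤ ∫ t in (0 : ℝ)..h, deriv (fun t : ℝ => W (y + t • v)) t := by
    refine intervalIntegral.integral_mono_ae_restrict hh intervalIntegrable_const
      hac.intervalIntegrable_deriv ?_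
    rw [EventuallyLE, ae_restrict_iff' measurableSet_Icc]
    filter_upwards [hae] with t ht hmem
    obtain ⟨hd, hc⟩ := ht (hseg t hmem)
    have hl : HasDerivAt (fun t : ℝ => y + t • v) v t := by
      simpa using ((hasDerivAt_id t).smul_const v).const_add y
    have := hd.hasFDerivAt.comp_hasDerivAt t hl
    rw [show (fun t : ℝ => W (y + t • v)) = W ∘ fun t : ℝ => y + t • v from rfl, this.deriv]
    exact hc
  rw [hac.integral_deriv_eq_sub] at hle
  simpa [mul_comm] using hle

/-- Almost every line is good, so good base points are dense; continuity of `W` reaches the others.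
-/
theorem mul_le_sub_of_ae_fderiv_ge {W : EuclideanSpace ℝ (Fin n) → ℝ}
    {K : NNReal} {U : Set (EuclideanSpace ℝ (Fin n))} (hUo : IsOpen U) (hUc : Convex ℝ U)
    (hW : LipschitzOnWith K W U) {v : EuclideanSpace ℝ (Fin n)} {c : ℝ}
    (hae : ∀ᵐ z, z ∈ U → DifferentiableAt ℝ W z ∧ c ≤ fderiv ℝ W z v)
    {y : EuclideanSpace ℝ (Fin n)} {h : ℝ} (hh : 0 ≤ h)
    (hy : y ∈ U) (hyh : y + h • v ∈ U) :
    c * h ≤ W (y + h • v) - W y := by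
  have hdense : Dense {z : EuclideanSpace ℝ (Fin n) | ∀ᵐ t : ℝ, z + t • v ∈ U →
      DifferentiableAt ℝ W (z + t • v) ∧ c ≤ fderiv ℝ W (z + t • v) v} := by
    refine Measure.dense_of_ae (μ := volume) ?_
    filter_upwards [ae_ae_add_smul_notMem (ae_iff.1 hae) v] with z hz
    filter_upwards [hz] with t ht
    simpa using ht
  have hfreq := mem_closure_iff_frequently.1 (hdense y)
  have hadd : Tendsto (fun z => z + h • v) (𝓝 y) (𝓝 (y + h • v)) :=
    (continuous_id.add continuous_const).tendsto y
  have hcont : Tendsto (fun z => W (z + h • v) - W z) (𝓝 y) (𝓝 (W (y + h • v) - W y)) :=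
    ((hW.continuousOn.continuousAt (hUo.mem_nhds hyh)).tendsto.comp hadd).sub
      (hW.continuousOn.continuousAt (hUo.mem_nhds hy)).tendsto
  refine ge_of_tendsto_of_frequently hcont ?_
  refine (hfreq.and_eventually ((hUo.eventually_mem hy).and
    (hadd.eventually (hUo.eventually_mem hyh)))).mono ?_
  rintro z ⟨hz, hzU, hzh⟩
  exact mul_le_sub_of_ae_fderiv_ge_of_ae_line hUc hW hh hzU hzh hz

/-- Compactness: gradients at violating points tending to `x` are bounded by `K`, and a limit of a
subsequence would be a generalized gradient violating `hc`. -/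
theorem eventually_lt_fderiv_of_forall_clarkeGradient {Z : Set (EuclideanSpace ℝ (Fin n))}
    {W : EuclideanSpace ℝ (Fin n) → ℝ} {x v : EuclideanSpace ℝ (Fin n)}
    {K : NNReal} {U : Set (EuclideanSpace ℝ (Fin n))} (hU : U ∈ 𝓝 x)
    (hW : LipschitzOnWith K W U) {c : ℝ}
    (hc : ∀ η ∈ clarkeGradient Z W x, c < inner ℝ η v) :
    ∀ᶠ z in 𝓝 x, z ∉ Z → DifferentiableAt ℝ W z → c < fderiv ℝ W z v := by
  by_contra hcon
  rw [not_eventually] at hcon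
  obtain ⟨u, hu, hPu⟩ := exists_seq_forall_of_frequently
    (hcon.and_eventually (eventually_mem_nhds_iff.2 hU))
  have hbdd : ∀ i, gradient W (u i) ∈ Metric.closedBall (0 : EuclideanSpace ℝ (Fin n)) K := by
    intro i
    rw [mem_closedBall_zero_iff, gradient, LinearIsometryEquiv.norm_map]
    exact norm_fderiv_le_of_lipschitzOn ℝ (hPu i).2 hW
  obtain ⟨η, -, k, hk, hη⟩ := (isCompact_closedBall _ _).tendsto_subseq hbdd
  have hprop : ∀ i, u i ∉ Z ∧ DifferentiableAt ℝ W (u i) ∧ fderiv ℝ W (u i) v ≤ c := by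
    intro i
    have := (hPu i).1
    push Not at this
    exact this
  have hmem : η ∈ clarkeGradient Z W x :=
    subset_convexHull ℝ _ ⟨u ∘ k, hu.comp hk.tendsto_atTop,
      fun i => ⟨(hprop _).1, (hprop _).2.1⟩, hη⟩
  refine (hc η hmem).not_ge (le_of_tendsto (hη.inner tendsto_const_nhds)
    (Eventually.of_forall fun i => ?_))
  simp only [Function.comp_apply, inner_gradient_left]
  exact (hprop _).2.2

/-- The curve is replaced by its tangent ray; the Lipschitz bound turns the `o(z - t)` gap into a
loss absorbed by `c - r`. -/
theorem eventually_mul_lt_sub_of_forall_clarkeGradient {Z : Set (EuclideanSpace ℝ (Fin n))}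
    (hZ : volume Z = 0) {W : EuclideanSpace ℝ (Fin n) → ℝ}
    {K : NNReal} {U : Set (EuclideanSpace ℝ (Fin n))}
    {x : ℝ → EuclideanSpace ℝ (Fin n)} {v : EuclideanSpace ℝ (Fin n)} {t : ℝ}
    (hx : HasDerivWithinAt x v (Set.Ici t) t) (hU : U ∈ 𝓝 (x t))
    (hW : LipschitzOnWith K W U) {c : ℝ}
    (hc : ∀ η ∈ clarkeGradient Z W (x t), c < inner ℝ η v) {r : ℝ} (hr : r < c) :
    ∀ᶠ z in 𝓝[>] t, r * (z - t) ≤ W (x z) - W (x t) := by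
  obtain ⟨δ, hδ, hball⟩ := Metric.mem_nhds_iff.1 (inter_mem hU
    (eventually_lt_fderiv_of_forall_clarkeGradient hU hW hc))
  have hWb : LipschitzOnWith K W (Metric.ball (x t) δ) :=
    hW.mono fun z hz => (hball hz).1
  have hae : ∀ᵐ z, z ∈ Metric.ball (x t) δ → DifferentiableAt ℝ W z ∧ c ≤ fderiv ℝ W z v := by
    filter_upwards [hWb.ae_differentiableWithinAt_of_mem, measure_eq_zero_iff_ae_notMem.1 hZ]
      with z hd hzZ hzb
    have hd' := (hd hzb).differentiableAt (Metric.isOpen_ball.mem_nhds hzb)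
    exact ⟨hd', ((hball hzb).2 hzZ hd').le⟩
  have hcx : Tendsto x (𝓝[>] t) (𝓝 (x t)) :=
    hx.continuousWithinAt.tendsto.mono_left (nhdsWithin_mono _ Set.Ioi_subset_Ici_self)
  have hcl : Tendsto (fun z : ℝ => x t + (z - t) • v) (𝓝[>] t) (𝓝 (x t)) := by
    have : Continuous fun z : ℝ => x t + (z - t) • v := by fun_prop
    have h := this.tendsto t
    simp only [sub_self, zero_smul, add_zero] at h
    exact h.mono_left nhdsWithin_le_nhds
  -- Chosen so that `K` times it is at most `c - r`, even if `K = 0`.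
  have hε : 0 < (c - r) / (K + 1) := div_pos (sub_pos.2 hr) (by positivity)
  have ho := ((hasDerivWithinAt_iff_isLittleO.1 hx).mono
    (nhdsWithin_mono _ Set.Ioi_subset_Ici_self)).def hε
  have hb : Metric.ball (x t) δ ∈ 𝓝 (x t) := Metric.ball_mem_nhds _ hδ
  filter_upwards [hcx hb, hcl hb, ho, self_mem_nhdsWithin] with z hz1 hz2 hz3 hz4
  have hzt : 0 < z - t := sub_pos.2 hz4
  have h1 := mul_le_sub_of_ae_fderiv_ge Metric.isOpen_ball (convex_ball _ _) hWb hae hzt.le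
    (Metric.mem_ball_self hδ) hz2
  have h2 := (hWb.norm_sub_le hz1 hz2).trans
    (mul_le_mul_of_nonneg_left (le_of_eq_of_le (by rw [sub_sub]) hz3) K.coe_nonneg)
  rw [Real.norm_eq_abs, Real.norm_of_nonneg hzt.le] at h2
  have h3 := (abs_le.1 h2).1
  have h4 : (K : ℝ) * ((c - r) / (K + 1) * (z - t)) ≤ (c - r) * (z - t) := by
    have hK : (K : ℝ) / (K + 1) ≤ 1 := (div_le_one (by positivity)).2 (by linarith)
    calc (K : ℝ) * ((c - r) / (K + 1) * (z - t))
        = (K : ℝ) / (K + 1) * ((c - r) * (z - t)) := by ring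
      _ ≤ 1 * ((c - r) * (z - t)) :=
          mul_le_mul_of_nonneg_right hK (mul_nonneg (sub_pos.2 hr).le hzt.le)
      _ = _ := one_mul _
  linarith

end LowerDini

/-! ### Comparison with the scalar equation `u' = -φ(u)`. -/

section Comparison

variable {φ u : ℝ → ℝ}

/-- The lower right Dini derivative of `-u` is at least `φ (u t)` wherever `u t > 0`. -/
def DecaysAtRate (φ u : ℝ → ℝ) : Prop :=
  ∀ t, 0 ≤ t → 0 < u t → ∀ r < φ (u t), ∀ᶠ z in 𝓝[>] t, u z ≤ u t - r * (z - t)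

theorem hasDerivAt_integral_one_div (hφc : ContinuousOn φ (Set.Ici 0))
    (hφpos : ∀ r : ℝ, 0 < r → 0 < φ r)
    (hφint : ∀ r : ℝ, 0 ≤ r → IntervalIntegrable (fun v => 1 / φ v) volume 0 r)
    {r : ℝ} (hr : 0 < r) :
    HasDerivAt (fun s => ∫ v in (0 : ℝ)..s, 1 / φ v) (1 / φ r) r := by
  have hcont : ContinuousOn (fun v => 1 / φ v) (Set.Ioi 0) :=
    continuousOn_const.div (hφc.mono Set.Ioi_subset_Ici_self) fun v hv => (hφpos v hv).ne'
  exact intervalIntegral.integral_hasDerivAt_right (hφint r hr.le)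
    (hcont.stronglyMeasurableAtFilter isOpen_Ioi r hr)
    (hcont.continuousAt (isOpen_Ioi.mem_nhds hr))

theorem integral_one_div_pos (hφpos : ∀ r : ℝ, 0 < r → 0 < φ r)
    (hφint : ∀ r : ℝ, 0 ≤ r → IntervalIntegrable (fun v => 1 / φ v) volume 0 r)
    {r : ℝ} (hr : 0 < r) : 0 < ∫ v in (0 : ℝ)..r, 1 / φ v :=
  intervalIntegral.intervalIntegral_pos_of_pos_on (hφint r hr.le)
    (fun v hv => one_div_pos.2 (hφpos v hv.1)) hr

theorem integral_one_div_mono (hφpos : ∀ r : ℝ, 0 < r → 0 < φ r) (hφ0 : φ 0 = 0)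
    (hφint : ∀ r : ℝ, 0 ≤ r → IntervalIntegrable (fun v => 1 / φ v) volume 0 r)
    {r s : ℝ} (hr : 0 ≤ r) (hrs : r ≤ s) :
    ∫ v in (0 : ℝ)..r, 1 / φ v ≤ ∫ v in (0 : ℝ)..s, 1 / φ v := by
  have hi : IntervalIntegrable (fun v => 1 / φ v) volume r s :=
    (hφint r hr).symm.trans (hφint s (hr.trans hrs))
  have h := intervalIntegral.integral_add_adjacent_intervals (hφint r hr) hi
  have h0 : 0 ≤ ∫ v in r..s, 1 / φ v := by
    refine intervalIntegral.integral_nonneg hrs fun v hv => ?_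
    exact one_div_nonneg.2 ((hr.trans hv.1).eq_or_lt.elim
      (fun h => by rw [← h, hφ0]) fun h => (hφpos v h).le)
  linarith

theorem integral_one_div_le_sub (hφc : ContinuousOn φ (Set.Ici 0)) (hφ0 : φ 0 = 0)
    (hφpos : ∀ r : ℝ, 0 < r → 0 < φ r)
    (hφint : ∀ r : ℝ, 0 ≤ r → IntervalIntegrable (fun v => 1 / φ v) volume 0 r)
    (hu : ContinuousOn u (Set.Ici 0)) (hu0 : ∀ t, 0 ≤ t → 0 ≤ u t)
    (hdecay : DecaysAtRate φ u) {a b : ℝ} (ha : 0 ≤ a) (hab : a ≤ b)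
    (hpos : ∀ t ∈ Set.Icc a b, 0 < u t) :
    ∫ v in (0 : ℝ)..u b, 1 / φ v ≤ (∫ v in (0 : ℝ)..u a, 1 / φ v) - (b - a) := by
  set Φ : ℝ → ℝ := fun s => ∫ v in (0 : ℝ)..s, 1 / φ v with hΦ
  have hΦd : ∀ r, 0 < r → HasDerivAt Φ (1 / φ r) r := fun r hr =>
    hasDerivAt_integral_one_div hφc hφpos hφint hr
  have hcomp : ContinuousOn (fun t => Φ (u t)) (Set.Icc a b) := fun t ht =>
    (hΦd _ (hpos t ht)).continuousAt.comp_continuousWithinAt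
      ((hu t (ha.trans ht.1)).mono fun s hs => ha.trans hs.1)
  refine image_le_of_liminf_slope_right_le_deriv_boundary (f := fun t => Φ (u t))
    (B := fun t => Φ (u a) - (t - a)) (B' := fun _ => -1) hcomp (by simp)
    (by fun_prop) (fun t _ => ?_) ?_ (Set.right_mem_Icc.2 hab)
  · simpa using (((hasDerivAt_id t).sub_const a).const_sub (Φ (u a))).hasDerivWithinAt
  intro t ht r hr
  have ht0 : 0 ≤ t := ha.trans ht.1
  have hut : 0 < u t := hpos t (Set.Ico_subset_Icc_self ht)
  have hφt := hφpos _ hut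
  -- Such a `ρ` exists because `r > -1`: the upper bound lets the decay hypothesis apply, the lower
  -- one makes the slope of `Φ` along the comparison line less than `r`.
  obtain ⟨ρ, hρ1, hρ2⟩ : ∃ ρ, -r * φ (u t) < ρ ∧ ρ < φ (u t) :=
    exists_between (by nlinarith)
  have hline : HasDerivAt (fun z : ℝ => u t - ρ * (z - t)) (-ρ) t := by
    simpa using (((hasDerivAt_id t).sub_const t).const_mul ρ).const_sub (u t)
  have hd : HasDerivAt (fun z : ℝ => Φ (u t - ρ * (z - t))) (1 / φ (u t) * -ρ) t := by
    refine HasDerivAt.comp (h₂ := Φ) t ?_ hline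
    simpa using hΦd _ hut
  have hlt : 1 / φ (u t) * -ρ < r := by
    rw [one_div_mul_eq_div, div_lt_iff₀ hφt]
    linarith
  have hslope : ∀ᶠ z in 𝓝[>] t, slope (fun z : ℝ => Φ (u t - ρ * (z - t))) t z < r :=
    ((hasDerivAt_iff_tendsto_slope.1 hd).mono_left
      (nhdsWithin_mono _ fun z hz => ne_of_gt hz)).eventually_lt_const hlt
  refine Eventually.frequently ?_
  filter_upwards [hslope, hdecay t ht0 hut ρ hρ2, self_mem_nhdsWithin] with z hz1 hz2 hz3
  have hzt : 0 < z - t := sub_pos.2 hz3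
  refine lt_of_le_of_lt ?_ hz1
  rw [slope_def_field, slope_def_field]
  simp only [sub_self, mul_zero, sub_zero]
  gcongr
  exact integral_one_div_mono hφpos hφ0 hφint (hu0 z (ht0.trans hz3.le)) hz2

/-- If `u` stayed positive on `[0, B]`, then `Φ(u B) ≤ B - B = 0`, contradicting positivity of `Φ`.
-/
theorem exists_eq_zero_of_decaysAtRate (hφc : ContinuousOn φ (Set.Ici 0)) (hφ0 : φ 0 = 0)
    (hφpos : ∀ r : ℝ, 0 < r → 0 < φ r)
    (hφint : ∀ r : ℝ, 0 ≤ r → IntervalIntegrable (fun v => 1 / φ v) volume 0 r)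
    (hu : ContinuousOn u (Set.Ici 0)) (hu0 : ∀ t, 0 ≤ t → 0 ≤ u t)
    (hdecay : DecaysAtRate φ u) :
    ∃ T, 0 ≤ T ∧ T ≤ ∫ v in (0 : ℝ)..u 0, 1 / φ v ∧ u T = 0 := by
  by_contra! hcon
  set B := ∫ v in (0 : ℝ)..u 0, 1 / φ v with hB
  have hB0 : 0 ≤ B := by
    have h := integral_one_div_mono hφpos hφ0 hφint le_rfl (hu0 0 le_rfl)
    rwa [intervalIntegral.integral_same] at h
  have hpos : ∀ t ∈ Set.Icc 0 B, 0 < u t := fun t ht =>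
    (hu0 t ht.1).lt_of_ne' (hcon t ht.1 ht.2)
  have h := integral_one_div_le_sub hφc hφ0 hφpos hφint hu hu0 hdecay le_rfl hB0 hpos
  have h' := integral_one_div_pos hφpos hφint (hpos B ⟨hB0, le_rfl⟩)
  linarith

/-- Past the last zero `s` before `t`, `Φ(u)` decreases, so `u ≥ u t > 0` just right of `s`, against
continuity at `s`. -/
theorem eq_zero_of_decaysAtRate (hφc : ContinuousOn φ (Set.Ici 0)) (hφ0 : φ 0 = 0)
    (hφpos : ∀ r : ℝ, 0 < r → 0 < φ r)
    (hφint : ∀ r : ℝ, 0 ≤ r → IntervalIntegrable (fun v => 1 / φ v) volume 0 r)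
    (hu : ContinuousOn u (Set.Ici 0)) (hu0 : ∀ t, 0 ≤ t → 0 ≤ u t)
    (hdecay : DecaysAtRate φ u) {T t : ℝ} (hT : 0 ≤ T) (huT : u T = 0) (ht : T ≤ t) :
    u t = 0 := by
  by_contra hne
  have hut : 0 < u t := (hu0 t (hT.trans ht)).lt_of_ne' hne
  have hcIcc : ContinuousOn u (Set.Icc T t) := hu.mono fun s hs => hT.trans hs.1
  have hclosed : IsClosed (Set.Icc T t ∩ u ⁻¹' {0}) :=
    hcIcc.preimage_isClosed_of_isClosed isClosed_Icc isClosed_singleton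
  obtain ⟨s, ⟨⟨hTs, hst⟩, hus⟩, hmax⟩ :=
    (isCompact_Icc.of_isClosed_subset hclosed Set.inter_subset_left).exists_isGreatest
      ⟨T, Set.left_mem_Icc.2 ht, huT⟩
  have hus : u s = 0 := hus
  have hs0 : 0 ≤ s := hT.trans hTs
  have hst' : s < t := hst.lt_of_ne fun h => hne (h ▸ hus)
  have hpos : ∀ z, s < z → z ≤ t → 0 < u z := fun z hz hzt =>
    (hu0 z (hs0.trans hz.le)).lt_of_ne' fun h =>
      (hmax ⟨⟨hTs.trans hz.le, hzt⟩, h⟩).not_gt hz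
  have hle : ∀ z, s < z → z ≤ t → u t ≤ u z := by
    intro z hz hzt
    by_contra! hlt
    have h := integral_one_div_le_sub hφc hφ0 hφpos hφint hu hu0 hdecay (hs0.trans hz.le) hzt
      fun w hw => hpos w (hz.trans_le hw.1) hw.2
    have hzt' : z < t := hzt.lt_of_ne fun h => hlt.ne (h ▸ rfl)
    have h' := integral_one_div_mono hφpos hφ0 hφint (hpos z hz hzt).le hlt.le
    linarith
  have hlim : Tendsto u (𝓝[>] s) (𝓝 (u s)) :=
    (hu s hs0).tendsto.mono_left (nhdsWithin_mono _ fun z hz => hs0.trans (le_of_lt hz))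
  have := ge_of_tendsto hlim (b := u t) (by
    filter_upwards [Ioo_mem_nhdsGT hst'] with z hz
    exact hle z hz.1 hz.2.le)
  linarith

end Comparison

/-! ### Solutions, invariance and the Lie derivative. -/

section Flow

variable {n : ℕ} {f : EuclideanSpace ℝ (Fin n) → EuclideanSpace ℝ (Fin n)}
  {V : EuclideanSpace ℝ (Fin n) → ℝ}
  {x₀ : EuclideanSpace ℝ (Fin n)} {x : ℝ → EuclideanSpace ℝ (Fin n)}

theorem IsSolution.continuousOn (hx : IsSolution f x₀ x) : ContinuousOn x (Set.Ici 0) :=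
  fun t ht => (hx.2 t ht).continuousWithinAt

theorem IsSolution.shift (hx : IsSolution f x₀ x) {s : ℝ} (hs : 0 ≤ s) :
    IsSolution f (x s) fun t => x (t + s) := by
  refine ⟨by simp, fun t ht => ?_⟩
  have h := (hx.2 (t + s) (add_nonneg ht hs)).scomp t
    (((hasDerivAt_id t).add_const s).hasDerivWithinAt (s := Set.Ici 0))
    fun z hz => add_nonneg hz hs
  rwa [one_smul] at h

theorem HasUniqueSolutions.eqOn (hsol : HasUniqueSolutions f) {y : ℝ → EuclideanSpace ℝ (Fin n)}
    (hx : IsSolution f x₀ x) (hy : IsSolution f x₀ y) : Set.EqOn x y (Set.Ici 0) := by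
  obtain ⟨z, -, hz⟩ := hsol x₀
  exact (hz x hx).trans (hz y hy).symm

/-- Any solution issuing from `x s` is the shift of `x` by `s`. -/
theorem stronglyInvariant_image_Ici (hsol : HasUniqueSolutions f) (hx : IsSolution f x₀ x)
    {T : ℝ} (hT : 0 ≤ T) : StronglyInvariant f (x '' Set.Ici T) := by
  rintro _ ⟨s, hs, rfl⟩ y hy t ht
  have h := hsol.eqOn (hx.shift (hT.trans hs)) hy ht
  exact ⟨t + s, le_add_of_nonneg_of_le ht hs, h⟩

theorem IsSolution.antitoneOn_comp (hV : ContDiff ℝ 1 V) (hLV : ∀ x, lieDeriv f V x ≤ 0)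
    (hx : IsSolution f x₀ x) : AntitoneOn (fun t => V (x t)) (Set.Ici 0) := by
  refine antitoneOn_of_hasDerivWithinAt_nonpos (convex_Ici 0)
    (f' := fun t => lieDeriv f V (x t)) (hV.continuous.comp_continuousOn hx.continuousOn)
    (fun t ht => ?_) fun t _ => hLV _
  exact ((hV.differentiable one_ne_zero _).hasFDerivAt.comp_hasDerivWithinAt t
    (hx.2 t (interior_subset ht))).mono interior_subset

theorem stronglyInvariant_sublevel (hV : ContDiff ℝ 1 V) (hLV : ∀ x, lieDeriv f V x ≤ 0) (c : ℝ) :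
    StronglyInvariant f {y | V y ≤ c} := by
  intro y hy x hx t ht
  have h := hx.antitoneOn_comp hV hLV (Set.mem_Ici.2 le_rfl) ht ht
  simp only [hx.1] at h
  exact h.trans hy

theorem exists_lipschitzOnWith_lieDeriv (hVLip : LocallyLipschitz (gradient V))
    (hfLip : LocallyLipschitzOn {0}ᶜ f) {y : EuclideanSpace ℝ (Fin n)} (hy : y ≠ 0) :
    ∃ K : NNReal, ∃ U ∈ 𝓝 y, LipschitzOnWith K (lieDeriv f V) U := by
  obtain ⟨K₁, U₁, hU₁, h₁⟩ := hVLip y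
  obtain ⟨K₂, U₂, hU₂, h₂⟩ := hfLip (x := y) hy
  rw [isOpen_compl_singleton.nhdsWithin_eq hy] at hU₂
  have hb : ∀ᶠ z in 𝓝 y, ‖gradient V z‖ < ‖gradient V y‖ + 1 :=
    (h₁.continuousOn.continuousAt hU₁).norm.eventually_lt_const (lt_add_one _)
  have hb' : ∀ᶠ z in 𝓝 y, ‖f z‖ < ‖f y‖ + 1 :=
    (h₂.continuousOn.continuousAt hU₂).norm.eventually_lt_const (lt_add_one _)
  refine ⟨(‖gradient V y‖₊ + 1) * K₂ + K₁ * (‖f y‖₊ + 1),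
    U₁ ∩ U₂ ∩ {z | ‖gradient V z‖ < ‖gradient V y‖ + 1 ∧ ‖f z‖ < ‖f y‖ + 1},
    inter_mem (inter_mem hU₁ hU₂) (hb.and hb'), ?_⟩
  refine LipschitzOnWith.of_dist_le_mul ?_
  rintro z ⟨⟨hz₁, hz₂⟩, hzb, -⟩ w ⟨⟨hw₁, hw₂⟩, -, hwb⟩
  have e : lieDeriv f V z - lieDeriv f V w =
      inner ℝ (gradient V z) (f z - f w) + inner ℝ (gradient V z - gradient V w) (f w) := by
    simp only [lieDeriv, ← inner_gradient_left, inner_sub_left, inner_sub_right]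
    ring
  rw [Real.dist_eq, e, dist_eq_norm]
  push_cast
  have g₁ := h₁.norm_sub_le hz₁ hw₁
  have g₂ := h₂.norm_sub_le hz₂ hw₂
  calc _ ≤ ‖gradient V z‖ * ‖f z - f w‖ + ‖gradient V z - gradient V w‖ * ‖f w‖ :=
        (abs_add_le _ _).trans (add_le_add (abs_real_inner_le_norm _ _)
          (abs_real_inner_le_norm _ _))
    _ ≤ (‖gradient V y‖ + 1) * (K₂ * ‖z - w‖) + (K₁ * ‖z - w‖) * (‖f y‖ + 1) := by gcongr
    _ = _ := by ring

theorem continuous_lieDeriv (hf : Continuous f) (hV : ContDiff ℝ 1 V) :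
    Continuous (lieDeriv f V) :=
  (hV.continuous_fderiv one_ne_zero).clm_apply hf

theorem decaysAtRate_neg_lieDeriv (hf0 : f 0 = 0) (hfLip : LocallyLipschitzOn {0}ᶜ f)
    (hVLip : LocallyLipschitz (gradient V)) {φ : ℝ → ℝ}
    {Z : Set (EuclideanSpace ℝ (Fin n))} (hZ : volume Z = 0)
    {S : Set (EuclideanSpace ℝ (Fin n))} (hS : StronglyInvariant f S)
    (hSφ : ∀ y ∈ S \ {z | lieDeriv f V z = 0}, ∀ a ∈ setLieDeriv Z f (lieDeriv f V) y,
        φ (-lieDeriv f V y) ≤ a)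
    (hx₀ : x₀ ∈ S) (hx : IsSolution f x₀ x) :
    DecaysAtRate φ fun t => -lieDeriv f V (x t) := by
  intro t ht hpos r hr
  have hne : lieDeriv f V (x t) ≠ 0 := fun h => by simp [h] at hpos
  -- `f` is Lipschitz only away from the origin, but there `L_f V` vanishes.
  have hx0 : x t ≠ 0 := fun h => hne (by simp [lieDeriv, h, hf0])
  obtain ⟨K, U, hU, hK⟩ := exists_lipschitzOnWith_lieDeriv hVLip hfLip hx0
  obtain ⟨c, hrc, hc⟩ := exists_between hr
  filter_upwards [eventually_mul_lt_sub_of_forall_clarkeGradient hZ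
    ((hx.2 t ht).mono (Set.Ici_subset_Ici.2 ht)) hU hK
    (fun η hη => hc.trans_le (hSφ _ ⟨hS _ hx₀ x hx t ht, hne⟩ _ ⟨η, hη, rfl⟩)) hrc] with z hz
  linarith

end Flow

/-! ### Finite-time and fixed-time convergence. -/

theorem mainTheorem2 {n : ℕ}
    (f : EuclideanSpace ℝ (Fin n) → EuclideanSpace ℝ (Fin n))
    (hf : Continuous f) (hf0 : f 0 = 0) (hsol : HasUniqueSolutions f)
    (hfLip : LocallyLipschitzOn {0}ᶜ f)
    (V : EuclideanSpace ℝ (Fin n) → ℝ)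
    (hV : ContDiff ℝ 1 V) (hVLip : LocallyLipschitz (gradient V))
    (hVcpt : ∀ c : ℝ, IsCompact {x | V x ≤ c}) (hVbdd : BddBelow (Set.range V))
    (hLV : ∀ x, lieDeriv f V x ≤ 0)
    (φ : ℝ → ℝ) (hφc : ContinuousOn φ (Set.Ici 0)) (hφm : MonotoneOn φ (Set.Ici 0))
    (hφ0 : φ 0 = 0) (hφpos : ∀ r : ℝ, 0 < r → 0 < φ r)
    (hφint : ∀ r : ℝ, 0 ≤ r → IntervalIntegrable (fun v => 1 / φ v) volume 0 r)
    (Z : Set (EuclideanSpace ℝ (Fin n))) (hZ : volume Z = 0) :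
    (∀ x₀, StronglyInvariant f {y | V y ≤ V x₀}) ∧
    ∀ S : Set (EuclideanSpace ℝ (Fin n)), StronglyInvariant f S →
      -- `min L̃_f (L_f V) (y) ≥ φ (- L_f V (y))` on `S \ M`
      (∀ y ∈ S \ {z | lieDeriv f V z = 0}, ∀ a ∈ setLieDeriv Z f (lieDeriv f V) y,
        φ (-lieDeriv f V y) ≤ a) →
      ∀ x₀ ∈ S, ∀ x : ℝ → EuclideanSpace ℝ (Fin n), IsSolution f x₀ x →
        ReachesWithin x (largestInvariantSubset f ({z | lieDeriv f V z = 0} ∩ S))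
          (∫ v in (0 : ℝ)..(-lieDeriv f V x₀), 1 / φ v) ∧
        ∀ T_M : ℝ, (∀ r : ℝ, 0 ≤ r → ∫ v in (0 : ℝ)..r, 1 / φ v ≤ T_M) →
          ReachesWithin x (largestInvariantSubset f ({z | lieDeriv f V z = 0} ∩ S)) T_M := by
  refine ⟨fun x₀ => stronglyInvariant_sublevel hV hLV (V x₀), fun S hS hSφ x₀ hx₀ x hx => ?_⟩
  have hdecay := decaysAtRate_neg_lieDeriv hf0 hfLip hVLip hZ hS hSφ hx₀ hx
  have hu : ContinuousOn (fun t => -lieDeriv f V (x t)) (Set.Ici 0) :=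
    ((continuous_lieDeriv hf hV).comp_continuousOn hx.continuousOn).neg
  have hu0 : ∀ t, 0 ≤ t → 0 ≤ -lieDeriv f V (x t) := fun t _ => neg_nonneg.2 (hLV _)
  obtain ⟨T, hT, hTle, hTz⟩ :=
    exists_eq_zero_of_decaysAtRate hφc hφ0 hφpos hφint hu hu0 hdecay
  have hzero : ∀ t, T ≤ t → lieDeriv f V (x t) = 0 := fun t ht => neg_eq_zero.1
    (eq_zero_of_decaysAtRate hφc hφ0 hφpos hφint hu hu0 hdecay hT hTz ht)
  have hmem : ∀ t, T ≤ t →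
      x t ∈ largestInvariantSubset f ({z | lieDeriv f V z = 0} ∩ S) := by
    -- The tail of the trajectory after `T` is the invariant subset witnessing membership.
    refine fun t ht => (isGreatest_largestInvariantSubset f _).2
      ⟨?_, stronglyInvariant_image_Ici hsol hx hT⟩ ⟨t, ht, rfl⟩
    rintro _ ⟨s, hs, rfl⟩
    exact ⟨hzero s hs, hS x₀ hx₀ x hx s (hT.trans hs)⟩
  simp only [hx.1] at hTle
  exact ⟨⟨T, hT, hTle, hmem⟩, fun T_M hTM =>
    ⟨T, hT, hTle.trans (hTM _ (neg_nonneg.2 (hLV x₀))), hmem⟩⟩
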